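/- Let $n\ge 3$ and regard $S^n$ as the unit sphere of $\mathbb C\oplus\mathbb R^{n-1}$, $S^2$ as the unit sphere of $\mathbb C\oplus\mathbb R$, and put $p=(0,1)\in S^2$. For a smooth unit speed curve $\gamma=(z,b)$ in $S^2\cap\{b>0\}$ let $\nu=\gamma'\times\gamma=(\nu_1,\nu_2)\in\mathbb C\oplus\mathbb R$ be its unit normal in $S^2$, and consider the map $$G_\gamma(t,x)=(z(t),\,b(t)x),\qquad x\in S^{n-2},$$ into $S^n$ with unit normal field $N_\gamma(t,x)=(\nu_1(t),\nu_2(t)x)$. Mean curvature means the (unnormalized) trace of the second fundamental form in $S^n$, and $\gamma$ is called a complete $H$-curve if it is defined on all of $\mathbb R$ and $G_\gamma:\mathbb R\times S^{n-2}\to S^n$ is an immersion of constant mean curvature $H$ with respect to $N_\gamma$. For $h>0$, a flower type generating curve is a complete $(-h)$-curve that passes through $p$ and satisfies $$b^{\,n-2}\,\operatorname{Im}(\bar z z')=C-\frac{h}{n-1}\,b^{\,n-1}\quad\text{with } C=\frac{h}{n-1};$$ its spiral product $G_\gamma$ is the flower type Delaunay hypersurface of mean curvature $-h$. Then there are infinitely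 many $h>0$ for which there is a flower type generating curve $\gamma$ that is periodic with some period $L>0$ and for which $G_\gamma$ and $N_\gamma$ descend along $(t,x)\mapsto(e^{2\pi i t/L},x)$ to a smooth immersion $S^1\times S^{n-2}\to S^n$ together with a smooth unit normal field, with respect to which the immersion has constant mean curvature $-h$. -/

import Mathlib

open scoped Manifold ContDiff

/-- The round sphere `S^k`, the unit sphere of `ℝ^(k+1)`. -/
abbrev Sph (k : ℕ) : Type := Metric.sphere (0 : EuclideanSpace ℝ (Fin (k + 1))) 1

/-- The Euclidean space `ℂ ⊕ ℝ^(n-1)`, of real dimension `n + 1` (for `n ≥ 2`; the second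
summand is written `ℝ^((n-2)+1)`, so that its unit sphere is `Sph (n - 2)`).
The unit sphere of this space is `S^n`. -/
abbrev Ambient (n : ℕ) : Type := WithLp 2 (ℂ × EuclideanSpace ℝ (Fin (n - 2 + 1)))

section CMC

variable {F : Type*} [NormedAddCommGroup F] [NormedSpace ℝ F]
  {X : Type*} [TopologicalSpace X] (I : ModelWithCorners ℝ F X)
  {M : Type*} [TopologicalSpace M] [ChartedSpace X M]
  {E : Type*} [NormedAddCommGroup E] [InnerProductSpace ℝ E]

/-- The differential at `p` of a map `f` from a manifold `M` to a vector space `E`. -/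
noncomputable def differential (f : M → E) (p : M) : TangentSpace I p →L[ℝ] E :=
  mfderiv I 𝓘(ℝ, E) f p

/-- `f : M → E` is a smooth immersion of the manifold `M` into the unit sphere of `E`, `N` is a
smooth unit normal field of `f` in that sphere, and the (unnormalized) mean curvature of `f`
with respect to `N`, i.e. the trace of the second fundamental form, is constantly `H`.

The shape operator at `p` is the endomorphism `S` of the tangent space of `M` with
`df ∘ S = - dN`; it exists and is unique when `M` has codimension one in the sphere, because
then `dN v` is orthogonal to `f` and `N` and so lies in the image of the injective map `df`. -/
structure IsCMCImmersion (f N : M → E) (H : ℝ) : Prop where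
  contMDiff : ContMDiff I 𝓘(ℝ, E) ∞ f
  mem_sphere : ∀ p, ‖f p‖ = 1
  injective_differential : ∀ p, Function.Injective (differential I f p)
  contMDiff_normal : ContMDiff I 𝓘(ℝ, E) ∞ N
  norm_normal : ∀ p, ‖N p‖ = 1
  normal_orthogonal_position : ∀ p, inner ℝ (N p) (f p) = 0
  normal_orthogonal_tangent : ∀ p v, inner ℝ (N p) (differential I f p v) = 0
  trace_shape : ∀ p, ∃ S : TangentSpace I p →ₗ[ℝ] TangentSpace I p,
    (∀ v, differential I f p (S v) = - differential I N p v) ∧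
      LinearMap.trace ℝ (TangentSpace I p) S = H

end CMC

/-- The singly spiral product `G(t, x) = (z(t), b(t) x)` generated by the curve
`γ = (z, b)` in `S^2 ⊂ ℂ ⊕ ℝ`. -/
noncomputable def spiralProduct (n : ℕ) (z : ℝ → ℂ) (b : ℝ → ℝ) (q : ℝ × Sph (n - 2)) :
    Ambient n :=
  WithLp.toLp 2 (z q.1, b q.1 • (q.2 : EuclideanSpace ℝ (Fin (n - 2 + 1))))

/-- The unit normal of the spiral product of a unit speed curve `γ = (z, b)`. If
`ν = γ' × γ = (ν₁, ν₂)` (cross product of `ℝ^3 = ℂ ⊕ ℝ`) is the unit normal of `γ` in `S^2`,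
it is `(ν₁(t), ν₂(t) x)`. -/
noncomputable def spiralNormal (n : ℕ) (z : ℝ → ℂ) (b : ℝ → ℝ) (q : ℝ × Sph (n - 2)) :
    Ambient n :=
  WithLp.toLp 2
    (-Complex.I * (b q.1 * deriv z q.1 - deriv b q.1 * z q.1),
      (-(starRingEnd ℂ (z q.1) * deriv z q.1).im) •
        (q.2 : EuclideanSpace ℝ (Fin (n - 2 + 1))))

/-- `γ = (z, b)` is a complete `H`-curve: a smooth curve in the open upper hemisphere
`{b > 0}` of `S^2`, defined on all of `ℝ` and parametrized by arc length, whose spiral product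
`ℝ × S^(n-2) → S^n` is an immersion of constant mean curvature `H`. -/
structure IsCompleteCMCCurve (n : ℕ) (H : ℝ) (z : ℝ → ℂ) (b : ℝ → ℝ) : Prop where
  contDiff_z : ContDiff ℝ ∞ z
  contDiff_b : ContDiff ℝ ∞ b
  mem_sphere : ∀ t, ‖z t‖ ^ 2 + b t ^ 2 = 1
  b_pos : ∀ t, 0 < b t
  unit_speed : ∀ t, ‖deriv z t‖ ^ 2 + deriv b t ^ 2 = 1
  cmc : IsCMCImmersion (𝓘(ℝ, ℝ).prod (𝓡 (n - 2)))
    (spiralProduct n z b) (spiralNormal n z b) H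

/-- `γ = (z, b)` is a flower type generating curve for `h`: a complete `(-h)`-curve which
passes through the point `p = (0, 1)` of `S^2 ⊂ ℂ ⊕ ℝ` and whose first integral takes the
value `C = h / (n - 1)`.

For `z = cos s * exp (i s₁)`, `b = sin s`, one has `im (conj z * z') = cos s ^ 2 * s₁'`, and
a curve of constant mean curvature `H` satisfies
`sin s ^ (n-2) * cos s ^ 2 * s₁' = C + H / (n-1) * sin s ^ (n-1)`; here `H = -h`. -/
structure IsFlowerCurve (n : ℕ) (h : ℝ) (z : ℝ → ℂ) (b : ℝ → ℝ) : Prop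
    extends IsCompleteCMCCurve n (-h) z b where
  passes_through_p : ∃ t, z t = 0 ∧ b t = 1
  first_integral : ∀ t, b t ^ (n - 2) * (starRingEnd ℂ (z t) * deriv z t).im =
    h / ((n : ℝ) - 1) - h / ((n : ℝ) - 1) * b t ^ (n - 1)

/-- The curve `γ = (z, b)` closes up with period `L > 0`, and its spiral product descends along
`(t, x) ↦ (exp (2 π i t / L), x)` to an immersion `f` of `S^1 × S^(n-2)` into `S^n`, with unit
normal field `N`, of constant mean curvature `H`. -/
structure InducesClosedCMCImmersion (n : ℕ) (H : ℝ) (z : ℝ → ℂ) (b : ℝ → ℝ) (L : ℝ)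
    (f N : Circle × Sph (n - 2) → Ambient n) : Prop where
  period_pos : 0 < L
  periodic_z : Function.Periodic z L
  periodic_b : Function.Periodic b L
  descends : ∀ (t : ℝ) (x : Sph (n - 2)),
    f (Circle.exp (2 * Real.pi * t / L), x) = spiralProduct n z b (t, x)
  normal_descends : ∀ (t : ℝ) (x : Sph (n - 2)),
    N (Circle.exp (2 * Real.pi * t / L), x) = spiralNormal n z b (t, x)
  cmc : IsCMCImmersion ((𝓡 1).prod (𝓡 (n - 2))) f N H

open scoped Manifold ContDiff Topology

/-! Put `m = n - 2`, `c = h / (n - 1)`, `S(u) = 1 + u + ... + u ^ m`. In polar form the first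
integral gives `θ' = c S(1/b) / (1 + b)`, and unit speed gives `b' ^ 2 = (1 - b) ((1 + b) - c ^ 2 (1
- b) S(1/b) ^ 2)`. If `a` is the minimal height, the right side is `(1 - b) (b - a)` times a
positive function (`sub_mul_psi`). The substitution `b = 1 - (1 - a) sin² x` therefore removes both
turning points: the profile becomes an explicit curve in `x`, and arc length is recovered from an
autonomous equation with positive periodic speed (`exists_periodic_flow`). Conversely, the first
integral and unit speed imply constant mean curvature (`isCompleteCMCCurve_of_first_integral`).

From one passage through the pole to the next, `x` advances by `π`, and `z` is multiplied by
`-exp(iΦ)`, where `Φ` is `sweptAngle`. If `Φ` is a rational multiple of `π`, the curve is periodic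
and the immersion descends.

It remains to see that `Φ(a)` is not constant. Its integrand extends continuously to `a = 1`, where
`Φ = π` (`sweptAngle_one`), while for `a < 1` the integrand is everywhere below `1`
(`angleRate_lt_one`), so `Φ < π`. By the intermediate value theorem infinitely many rational
multiples of `π` are attained. They belong to different `a`, hence to different `h` by
`flowerConst_strictMonoOn`. -/

/-! ### Differential and shape operator of a spiral product. -/

theorem inner_ambient {n : ℕ} (z w : ℂ) (x y : EuclideanSpace ℝ (Fin (n - 2 + 1))) :
    inner ℝ (WithLp.toLp 2 (z, x) : Ambient n) (WithLp.toLp 2 (w, y)) =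
      inner ℝ z w + inner ℝ x y := by
  simp [WithLp.prod_inner_apply]

theorem norm_sq_ambient {n : ℕ} (z : ℂ) (x : EuclideanSpace ℝ (Fin (n - 2 + 1))) :
    ‖(WithLp.toLp 2 (z, x) : Ambient n)‖ ^ 2 = ‖z‖ ^ 2 + ‖x‖ ^ 2 := by
  simp [WithLp.prod_norm_sq_eq_of_L2]

/-- The differential of the inclusion of the sphere into Euclidean space. -/
noncomputable def sphIncl {k : ℕ} (x : Sph k) :
    EuclideanSpace ℝ (Fin k) →L[ℝ] EuclideanSpace ℝ (Fin (k + 1)) :=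
  mfderiv (𝓡 k) 𝓘(ℝ, EuclideanSpace ℝ (Fin (k + 1)))
    ((↑) : Sph k → EuclideanSpace ℝ (Fin (k + 1))) x

theorem contMDiff_coe_sph {k : ℕ} : ContMDiff (𝓡 k) 𝓘(ℝ, EuclideanSpace ℝ (Fin (k + 1))) ∞
    ((↑) : Sph k → EuclideanSpace ℝ (Fin (k + 1))) :=
  have := Fact.mk (@finrank_euclideanSpace_fin ℝ _ (k + 1))
  contMDiff_coe_sphere

theorem hasMFDerivAt_sph {k : ℕ} (x : Sph k) :
    HasMFDerivAt (𝓡 k) 𝓘(ℝ, EuclideanSpace ℝ (Fin (k + 1)))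
      ((↑) : Sph k → EuclideanSpace ℝ (Fin (k + 1))) x (sphIncl x) :=
  (contMDiff_coe_sph.mdifferentiableAt (by simp)).hasMFDerivAt

theorem sphIncl_injective {k : ℕ} (x : Sph k) : Function.Injective (sphIncl x) :=
  have := Fact.mk (@finrank_euclideanSpace_fin ℝ _ (k + 1))
  injective_mvfderiv_subtypeVal_sphere x

theorem inner_sphIncl {k : ℕ} (x : Sph k) (v : EuclideanSpace ℝ (Fin k)) :
    inner ℝ (x : EuclideanSpace ℝ (Fin (k + 1))) (sphIncl x v) = 0 := by
  have := Fact.mk (@finrank_euclideanSpace_fin ℝ _ (k + 1))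
  have h := range_mvfderiv_subtypeVal (n := k) x
  have : sphIncl x v ∈ (ℝ ∙ (x : EuclideanSpace ℝ (Fin (k + 1))))ᗮ := by
    rw [← h]; exact ⟨v, rfl⟩
  exact Submodule.mem_orthogonal_singleton_iff_inner_right.1 this

section
variable {n : ℕ} {A : ℝ → ℂ} {B : ℝ → ℝ}

theorem contMDiff_spiralProduct (hA : ContDiff ℝ ∞ A) (hB : ContDiff ℝ ∞ B) :
    ContMDiff (𝓘(ℝ, ℝ).prod (𝓡 (n - 2))) 𝓘(ℝ, Ambient n) ∞ (spiralProduct n A B) := by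
  have h1 : ContMDiff (𝓘(ℝ, ℝ).prod (𝓡 (n - 2))) 𝓘(ℝ, ℂ) ∞
      (fun q : ℝ × Sph (n - 2) => A q.1) := hA.contMDiff.comp contMDiff_fst
  have h2 : ContMDiff (𝓘(ℝ, ℝ).prod (𝓡 (n - 2))) 𝓘(ℝ, ℝ) ∞
      (fun q : ℝ × Sph (n - 2) => B q.1) := hB.contMDiff.comp contMDiff_fst
  have h3 : ContMDiff (𝓘(ℝ, ℝ).prod (𝓡 (n - 2)))
      𝓘(ℝ, EuclideanSpace ℝ (Fin (n - 2 + 1))) ∞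
      (fun q : ℝ × Sph (n - 2) => (q.2 : EuclideanSpace ℝ (Fin (n - 2 + 1)))) :=
    contMDiff_coe_sph.comp contMDiff_snd
  exact ((WithLp.prodContinuousLinearEquiv 2 ℝ ℂ
    (EuclideanSpace ℝ (Fin (n - 2 + 1)))).symm.contDiff.contMDiff).comp
      (h1.prodMk_space (h2.smul h3))

theorem differential_spiralProduct {A' : ℂ} {B' : ℝ} (q : ℝ × Sph (n - 2))
    (hA : HasDerivAt A A' q.1) (hB : HasDerivAt B B' q.1)
    (v : ℝ × EuclideanSpace ℝ (Fin (n - 2))) :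
    differential (𝓘(ℝ, ℝ).prod (𝓡 (n - 2))) (spiralProduct n A B) q v =
      WithLp.toLp 2 (v.1 • A', (v.1 * B') • (q.2 : EuclideanSpace ℝ (Fin (n - 2 + 1))) +
        B q.1 • sphIncl q.2 v.2) := by
  let E := EuclideanSpace ℝ (Fin (n - 2 + 1))
  -- `Φ` extends the spiral product to a map of vector spaces; the chain rule with the sphere
  -- inclusion then gives the differential.
  let Φ : ℝ × E → Ambient n := fun p => WithLp.toLp 2 (A p.1, B p.1 • p.2)
  have hf : HasFDerivAt (fun p : ℝ × E => p.1) (ContinuousLinearMap.fst ℝ ℝ E)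
    (q.1, (q.2 : E)) := hasFDerivAt_fst
  have hs : HasFDerivAt (fun p : ℝ × E => p.2) (ContinuousLinearMap.snd ℝ ℝ E)
    (q.1, (q.2 : E)) := hasFDerivAt_snd
  have h1 := (hA.hasFDerivAt.comp (q.1, (q.2 : E)) hf)
  have h2 := (hB.hasFDerivAt.comp (q.1, (q.2 : E)) hf).smul hs
  obtain ⟨D, hD, hDv⟩ : ∃ D : ℝ × E →L[ℝ] Ambient n, HasFDerivAt Φ D (q.1, (q.2 : E)) ∧
      ∀ τ y, D (τ, y) = WithLp.toLp 2 (τ • A', (τ * B') • (q.2 : E) + B q.1 • y) := by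
    refine ⟨_, ((WithLp.prodContinuousLinearEquiv 2 ℝ ℂ E).symm.hasFDerivAt).comp _
      (h1.prodMk h2), fun τ y => ?_⟩
    simp [add_comm]
  have hincl : HasMFDerivAt (𝓘(ℝ, ℝ).prod (𝓡 (n - 2))) 𝓘(ℝ, ℝ × E)
      (fun q : ℝ × Sph (n - 2) => (q.1, (q.2 : E))) q
      ((ContinuousLinearMap.fst ℝ ℝ (EuclideanSpace ℝ (Fin (n - 2)))).prod
        ((sphIncl q.2).comp (ContinuousLinearMap.snd ℝ ℝ (EuclideanSpace ℝ (Fin (n - 2)))))) := by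
    rw [modelWithCornersSelf_prod, ← chartedSpaceSelf_prod]
    exact (hasMFDerivAt_fst (I := 𝓘(ℝ, ℝ)) (I' := 𝓡 (n - 2)) q).prodMk
      ((hasMFDerivAt_sph q.2).comp q (hasMFDerivAt_snd (I := 𝓘(ℝ, ℝ)) (I' := 𝓡 (n - 2)) q))
  have hcomp := (HasMFDerivAt.comp q hD.hasMFDerivAt hincl).mfderiv
  have hdiff : differential (𝓘(ℝ, ℝ).prod (𝓡 (n - 2))) (spiralProduct n A B) q = _ := hcomp
  rw [hdiff]
  exact hDv v.1 (sphIncl q.2 v.2)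

/-- The shape operator of a spiral product is diagonal: if `ν' = -κ γ'` along the curve, then
the trace of the shape operator is `κ - (n - 2) ν₂ / b`. -/
theorem trace_shape_spiralProduct {z w : ℝ → ℂ} {b β : ℝ → ℝ} {z' : ℂ} {b' κ : ℝ}
    (q : ℝ × Sph (n - 2)) (hz : HasDerivAt z z' q.1) (hb : HasDerivAt b b' q.1)
    (hw : HasDerivAt w (-κ * z') q.1) (hβ : HasDerivAt β (-κ * b') q.1) (hb0 : b q.1 ≠ 0) :
    ∃ S : TangentSpace (𝓘(ℝ, ℝ).prod (𝓡 (n - 2))) q →ₗ[ℝ]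
        TangentSpace (𝓘(ℝ, ℝ).prod (𝓡 (n - 2))) q,
      (∀ v, differential (𝓘(ℝ, ℝ).prod (𝓡 (n - 2))) (spiralProduct n z b) q (S v) =
        - differential (𝓘(ℝ, ℝ).prod (𝓡 (n - 2))) (spiralProduct n w β) q v) ∧
      LinearMap.trace ℝ (TangentSpace (𝓘(ℝ, ℝ).prod (𝓡 (n - 2))) q) S =
        κ - (n - 2 : ℕ) * (β q.1 / b q.1) := by
  let S : (ℝ × EuclideanSpace ℝ (Fin (n - 2))) →ₗ[ℝ] (ℝ × EuclideanSpace ℝ (Fin (n - 2))) :=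
    (κ • LinearMap.id).prodMap ((-(β q.1 / b q.1)) • LinearMap.id)
  refine ⟨S, fun v => ?_, ?_⟩
  · refine (differential_spiralProduct q hz hb (S v)).trans ?_
    refine Eq.trans ?_ (congrArg Neg.neg (differential_spiralProduct q hw hβ v)).symm
    generalize hv : (show ℝ × EuclideanSpace ℝ (Fin (n - 2)) from v) = v'
    obtain ⟨τ, y⟩ := v'
    subst hv
    change WithLp.toLp 2 ((κ * τ) • z', ((κ * τ) * b') • (q.2 : EuclideanSpace ℝ (Fin (n - 2 + 1)))
      + b q.1 • sphIncl q.2 (-(β q.1 / b q.1) • y)) =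
      - WithLp.toLp 2 (τ • (-κ * z'), (τ * (-κ * b')) • (q.2 : EuclideanSpace ℝ (Fin (n - 2 + 1)))
      + β q.1 • sphIncl q.2 y)
    rw [← WithLp.toLp_neg, Prod.neg_mk, map_smul, smul_smul]
    congr 2
    · simp; ring
    · rw [neg_add, ← neg_smul, ← neg_smul]
      congr 2
      · ring
      · field_simp
  · change LinearMap.trace ℝ (ℝ × EuclideanSpace ℝ (Fin (n - 2))) S = _
    rw [LinearMap.trace_prodMap']
    simp
    ring

theorem injective_differential_spiralProduct {z : ℝ → ℂ} {b : ℝ → ℝ} {z' : ℂ} {b' : ℝ}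
    (q : ℝ × Sph (n - 2)) (hz : HasDerivAt z z' q.1) (hb : HasDerivAt b b' q.1)
    (hu : ‖z'‖ ^ 2 + b' ^ 2 = 1) (hb0 : b q.1 ≠ 0) :
    Function.Injective
      (differential (𝓘(ℝ, ℝ).prod (𝓡 (n - 2))) (spiralProduct n z b) q) := by
  refine (injective_iff_map_eq_zero _).2 fun v hv => ?_
  have h := (differential_spiralProduct q hz hb v).symm.trans hv
  generalize hv' : (show ℝ × EuclideanSpace ℝ (Fin (n - 2)) from v) = v' at h
  obtain ⟨τ, y⟩ := v'
  subst hv'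
  have h1 : τ • z' = 0 := congrArg (fun p : Ambient n => p.fst) h
  have h2 : (τ * b') • (q.2 : EuclideanSpace ℝ (Fin (n - 2 + 1))) + b q.1 • sphIncl q.2 y = 0 :=
    congrArg (fun p : Ambient n => p.snd) h
  -- Pairing with the unit vector `q.2` kills the tangential term, so `τ` annihilates both
  -- components of the unit vector `γ'`.
  have h3 := congrArg (inner ℝ (q.2 : EuclideanSpace ℝ (Fin (n - 2 + 1)))) h2
  rw [inner_add_right, inner_smul_right, inner_smul_right, inner_sphIncl, inner_zero_right,
    real_inner_self_eq_norm_sq, norm_eq_of_mem_sphere] at h3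
  have h4 : τ * b' = 0 := by simpa using h3
  have h5 : τ = 0 := by
    by_contra hτ
    have e1 : z' = 0 := (smul_eq_zero.1 h1).resolve_left hτ
    have e2 : b' = 0 := (mul_eq_zero.1 h4).resolve_left hτ
    simp [e1, e2] at hu
  subst h5
  have h6 : sphIncl q.2 y = 0 := by simpa [hb0] using h2
  have h7 : y = 0 := sphIncl_injective q.2 (by rw [h6, map_zero])
  subst h7
  rfl

end

/-! ### From the first integral to constant mean curvature. -/

section
variable {z : ℝ → ℂ} {b : ℝ → ℝ}

theorem hasDerivAt_re {f : ℝ → ℂ} {f' : ℂ} {t : ℝ} (h : HasDerivAt f f' t) :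
    HasDerivAt (fun t => (f t).re) f'.re t :=
  Complex.reCLM.hasFDerivAt.comp_hasDerivAt t h

theorem hasDerivAt_im {f : ℝ → ℂ} {f' : ℂ} {t : ℝ} (h : HasDerivAt f f' t) :
    HasDerivAt (fun t => (f t).im) f'.im t :=
  Complex.imCLM.hasFDerivAt.comp_hasDerivAt t h

theorem deriv_eq_zero_of_const {f : ℝ → ℝ} {f' c t : ℝ} (hf : ∀ s, f s = c)
    (h : HasDerivAt f f' t) : f' = 0 := by
  have : f = fun _ => c := funext hf
  subst this
  exact h.unique (hasDerivAt_const t c)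

/-- The first integral says `ν₂ = c b - c b ^ (-m)`. Differentiating this reads off the curvature `κ
= -c (1 + m b ^ (-(m + 1)))` in `ν' = -κ γ'`. -/
theorem hasDerivAt_normal_snd (hb : ContDiff ℝ ∞ b) {m : ℕ} {c : ℝ}
    (hpos : ∀ t, 0 < b t)
    (hfirst : ∀ t, b t ^ m * (starRingEnd ℂ (z t) * deriv z t).im = c - c * b t ^ (m + 1))
    (t : ℝ) :
    HasDerivAt (fun t => -(starRingEnd ℂ (z t) * deriv z t).im)
      (-(-c * (1 + m / b t ^ (m + 1))) * deriv b t) t := by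
  have hbd : HasDerivAt b (deriv b t) t := (hb.differentiable (by simp) t).hasDerivAt
  have e : (fun t => -(starRingEnd ℂ (z t) * deriv z t).im) =
      fun t => c * b t - c * (b t ^ m)⁻¹ := by
    funext s
    have h1 := hfirst s
    have h2 := (hpos s).ne'
    field_simp
    rw [pow_succ] at h1
    linear_combination -h1
  rw [e]
  have h0 := (hpos t).ne'
  convert! (hbd.const_mul c).sub (((hbd.fun_pow m).fun_inv (pow_ne_zero m h0)).const_mul c) using 1
  -- The derivative of `b ^ m` carries the truncated exponent `m - 1`, so `m = 0` is treated apart.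
  rcases m with _ | m
  · simp
  · field_simp
    simp
    ring

theorem hasDerivAt_normal_fst (hz : ContDiff ℝ ∞ z) (hb : ContDiff ℝ ∞ b) (t : ℝ) :
    HasDerivAt (fun t => -Complex.I * (b t * deriv z t - deriv b t * z t))
      (-Complex.I * (b t * deriv (deriv z) t - deriv (deriv b) t * z t)) t := by
  have hbd : HasDerivAt b (deriv b t) t := (hb.differentiable (by simp) t).hasDerivAt
  have hzd : HasDerivAt z (deriv z t) t := (hz.differentiable (by simp) t).hasDerivAt
  have hz' : ContDiff ℝ ∞ (deriv z) := (contDiff_infty_iff_deriv.1 hz).2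
  have hb' : ContDiff ℝ ∞ (deriv b) := (contDiff_infty_iff_deriv.1 hb).2
  have hbd' := (hb'.differentiable (by simp) t).hasDerivAt
  have hzd' := (hz'.differentiable (by simp) t).hasDerivAt
  convert! ((hbd.ofReal_comp.mul hzd').sub (hbd'.ofReal_comp.mul hzd)).const_mul (-Complex.I) using 1
  ring

/-- Frenet equation `ν' = -κ γ'` in the complex component, at points where `b' ≠ 0`. -/
theorem frenet_fst_of_ne_zero (hz : ContDiff ℝ ∞ z) (hb : ContDiff ℝ ∞ b)
    (hS : ∀ t, ‖z t‖ ^ 2 + b t ^ 2 = 1) (hU : ∀ t, ‖deriv z t‖ ^ 2 + deriv b t ^ 2 = 1)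
    {κ t : ℝ} (hν : HasDerivAt (fun t => -(starRingEnd ℂ (z t) * deriv z t).im)
      (-κ * deriv b t) t) (hne : deriv b t ≠ 0) :
    -Complex.I * (b t * deriv (deriv z) t - deriv (deriv b) t * z t) = -κ * deriv z t := by
  have hbd (t : ℝ) : HasDerivAt b (deriv b t) t := (hb.differentiable (by simp) t).hasDerivAt
  have hzd (t : ℝ) : HasDerivAt z (deriv z t) t := (hz.differentiable (by simp) t).hasDerivAt
  have hz' : ContDiff ℝ ∞ (deriv z) := (contDiff_infty_iff_deriv.1 hz).2
  have hb' : ContDiff ℝ ∞ (deriv b) := (contDiff_infty_iff_deriv.1 hb).2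
  have hbd' := (hb'.differentiable (by simp) t).hasDerivAt
  have hzd' := (hz'.differentiable (by simp) t).hasDerivAt
  simp only [Complex.sq_norm, Complex.normSq_apply] at hS hU
  have h1 (t : ℝ) : (z t).re * (deriv z t).re + (z t).im * (deriv z t).im + b t * deriv b t = 0 := by
    have := deriv_eq_zero_of_const hS ((((hasDerivAt_re (hzd t)).mul (hasDerivAt_re (hzd t))).add
      ((hasDerivAt_im (hzd t)).mul (hasDerivAt_im (hzd t)))).add ((hbd t).pow 2))
    simp at this
    linarith
  have h2 := deriv_eq_zero_of_const hU ((((hasDerivAt_re hzd').mul (hasDerivAt_re hzd')).add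
      ((hasDerivAt_im hzd').mul (hasDerivAt_im hzd'))).add (hbd'.pow 2))
  have h3 := deriv_eq_zero_of_const h1 ((((hasDerivAt_re (hzd t)).mul (hasDerivAt_re hzd')).add
      ((hasDerivAt_im (hzd t)).mul (hasDerivAt_im hzd'))).add ((hbd t).mul hbd'))
  simp only [Complex.mul_im, Complex.conj_re, Complex.conj_im] at hν
  have h4 := hν.unique ((((hasDerivAt_re (hzd t)).mul (hasDerivAt_im hzd')).add
      ((hasDerivAt_im (hzd t)).neg.mul (hasDerivAt_re hzd'))).neg)
  have hS := hS t
  have hU := hU t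
  have h1 := h1 t
  simp at h2 h3 h4
  generalize deriv (deriv z) t = z2 at *
  generalize deriv (deriv b) t = b2 at *
  generalize deriv z t = z1 at *
  generalize deriv b t = b1 at *
  generalize z t = z0 at *
  generalize b t = b0 at *
  obtain ⟨x0, y0⟩ := z0
  obtain ⟨x1, y1⟩ := z1
  obtain ⟨x2, y2⟩ := z2
  simp only at *
  -- The vector `ν' + κ γ'` is orthogonal to `γ` and `ν`, and its real component vanishes by `hν`.
  -- So its complex component is orthogonal to `z` (`k1`) and to `ν₁` (`k2`): a linear system whose
  -- determinant is `b' ≠ 0` (`k3`).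
  have k1 : x0 * (b0 * y2 - b2 * y0 + κ * x1) + y0 * (-(b0 * x2 - b2 * x0) + κ * y1) = 0 := by
    linear_combination b0 * h4 + κ * h1
  have k2 : (b0 * y1 - b1 * y0) * (b0 * y2 - b2 * y0 + κ * x1) +
      (-(b0 * x1 - b1 * x0)) * (-(b0 * x2 - b2 * x0) + κ * y1) = 0 := by
    linear_combination (1 / 2 * (x0 * x0 + y0 * y0 + b0 ^ 2)) * h2
      - (x0 * x2 + y0 * y2 + b0 * b2) * h1 - (x0 * y1 - y0 * x1) * h4
  have k3 : x0 * (-(b0 * x1 - b1 * x0)) - y0 * (b0 * y1 - b1 * y0) = b1 := by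
    linear_combination b1 * hS - b0 * h1
  have k4 : b0 * y2 - b2 * y0 + κ * x1 = 0 := by
    apply mul_left_cancel₀ hne
    rw [← k3]
    linear_combination (-(b0 * x1 - b1 * x0)) * k1 - y0 * k2
  have k5 : -(b0 * x2 - b2 * x0) + κ * y1 = 0 := by
    apply mul_left_cancel₀ hne
    rw [← k3]
    linear_combination x0 * k2 - (b0 * y1 - b1 * y0) * k1
  apply Complex.ext
  · simp; linear_combination k4
  · simp; linear_combination k5

/-- Frenet equation `ν' = -κ γ'` in the complex component. -/
theorem frenet_fst (hz : ContDiff ℝ ∞ z) (hb : ContDiff ℝ ∞ b)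
    (hS : ∀ t, ‖z t‖ ^ 2 + b t ^ 2 = 1) (hU : ∀ t, ‖deriv z t‖ ^ 2 + deriv b t ^ 2 = 1)
    {κ : ℝ → ℝ} (hκ : Continuous κ)
    (hν : ∀ t, HasDerivAt (fun t => -(starRingEnd ℂ (z t) * deriv z t).im) (-κ t * deriv b t) t)
    (hcount : {t | deriv b t = 0}.Countable) (t : ℝ) :
    -Complex.I * (b t * deriv (deriv z) t - deriv (deriv b) t * z t) = -κ t * deriv z t := by
  have hz' : ContDiff ℝ ∞ (deriv z) := (contDiff_infty_iff_deriv.1 hz).2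
  have hb' : ContDiff ℝ ∞ (deriv b) := (contDiff_infty_iff_deriv.1 hb).2
  have hz'' := (contDiff_infty_iff_deriv.1 hz').2.continuous
  have hb'' := (contDiff_infty_iff_deriv.1 hb').2.continuous
  have hz1 := hz'.continuous
  have hz0 := hz.continuous
  have hb0 := hb.continuous
  -- Both sides are continuous and agree off a countable set, whose complement is dense.
  refine congrFun (Continuous.ext_on (hcount.dense_compl ℝ) ?_ ?_ fun s hs =>
    frenet_fst_of_ne_zero hz hb hS hU (hν s) hs) t <;> fun_prop

/-- A curve in the upper hemisphere with the first integral of the mean curvature equation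
generates a spiral product of constant mean curvature. -/
theorem isCompleteCMCCurve_of_first_integral {n : ℕ} {c : ℝ} (hn : 3 ≤ n)
    (hz : ContDiff ℝ ∞ z) (hb : ContDiff ℝ ∞ b)
    (hS : ∀ t, ‖z t‖ ^ 2 + b t ^ 2 = 1) (hpos : ∀ t, 0 < b t)
    (hU : ∀ t, ‖deriv z t‖ ^ 2 + deriv b t ^ 2 = 1)
    (hfirst : ∀ t, b t ^ (n - 2) * (starRingEnd ℂ (z t) * deriv z t).im =
      c - c * b t ^ (n - 2 + 1))
    (hcount : {t | deriv b t = 0}.Countable) :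
    IsCompleteCMCCurve n (-((n - 1 : ℝ) * c)) z b := by
  have hbd (t : ℝ) : HasDerivAt b (deriv b t) t := (hb.differentiable (by simp) t).hasDerivAt
  have hzd (t : ℝ) : HasDerivAt z (deriv z t) t := (hz.differentiable (by simp) t).hasDerivAt
  have hz' : ContDiff ℝ ∞ (deriv z) := (contDiff_infty_iff_deriv.1 hz).2
  have hb' : ContDiff ℝ ∞ (deriv b) := (contDiff_infty_iff_deriv.1 hb).2
  have hN2 := hasDerivAt_normal_snd hb hpos hfirst
  have hκ : Continuous fun t => -c * (1 + (n - 2 : ℕ) / b t ^ (n - 2 + 1)) := by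
    have := hb.continuous
    have h0 : ∀ t, b t ^ (n - 2 + 1) ≠ 0 := fun t => pow_ne_zero _ (hpos t).ne'
    fun_prop (disch := assumption)
  have hN1 (t : ℝ) := hasDerivAt_normal_fst hz hb t
  have hc1 : ContDiff ℝ ∞ fun t => -Complex.I * (b t * deriv z t - deriv b t * z t) := by
    have h1 := Complex.ofRealCLM.contDiff.comp hb
    have h2 := Complex.ofRealCLM.contDiff.comp hb'
    exact contDiff_const.mul ((h1.mul hz').sub (h2.mul hz))
  have hc2 : ContDiff ℝ ∞ fun t => -(starRingEnd ℂ (z t) * deriv z t).im := by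
    have h1 := Complex.conjCLE.contDiff.comp hz
    exact (Complex.imCLM.contDiff.comp (h1.mul hz')).neg
  have horth (t : ℝ) : (z t).re * (deriv z t).re + (z t).im * (deriv z t).im
      + b t * deriv b t = 0 := by
    simp only [Complex.sq_norm, Complex.normSq_apply] at hS
    have := deriv_eq_zero_of_const hS ((((hasDerivAt_re (hzd t)).mul (hasDerivAt_re (hzd t))).add
      ((hasDerivAt_im (hzd t)).mul (hasDerivAt_im (hzd t)))).add ((hbd t).pow 2))
    simp at this
    linarith
  refine ⟨hz, hb, hS, hpos, hU, ⟨contMDiff_spiralProduct hz hb, ?_, ?_, ?_, ?_, ?_, ?_, ?_⟩⟩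
  · intro q
    have h : ‖spiralProduct n z b q‖ ^ 2 = 1 := by
      rw [spiralProduct, norm_sq_ambient, norm_smul, norm_eq_of_mem_sphere, mul_one,
        Real.norm_eq_abs, sq_abs, hS]
    exact (pow_eq_one_iff_of_nonneg (norm_nonneg _) two_ne_zero).1 h
  · exact fun q => injective_differential_spiralProduct q (hzd _) (hbd _) (hU _) (hpos _).ne'
  · exact contMDiff_spiralProduct hc1 hc2
  · intro q
    have h : ‖spiralNormal n z b q‖ ^ 2 = 1 := by
      rw [spiralNormal, norm_sq_ambient, norm_smul, norm_eq_of_mem_sphere, mul_one,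
        Real.norm_eq_abs, sq_abs]
      have h1 := hS q.1
      have h2 := hU q.1
      have h3 := horth q.1
      simp only [Complex.sq_norm, Complex.normSq_apply] at h1 h2 ⊢
      simp
      linear_combination ((deriv z q.1).re * (deriv z q.1).re + (deriv z q.1).im * (deriv z q.1).im
        + deriv b q.1 ^ 2) * h1 + h2 - ((z q.1).re * (deriv z q.1).re
        + (z q.1).im * (deriv z q.1).im + b q.1 * deriv b q.1) * h3
    exact (pow_eq_one_iff_of_nonneg (norm_nonneg _) two_ne_zero).1 h
  · intro q
    rw [spiralProduct, spiralNormal, inner_ambient, inner_smul_left, inner_smul_right,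
      real_inner_self_eq_norm_sq, norm_eq_of_mem_sphere]
    simp [Complex.inner]
    ring
  · intro q v
    refine (congrArg (inner ℝ _) (differential_spiralProduct q (hzd _) (hbd _) v)).trans ?_
    generalize (show ℝ × EuclideanSpace ℝ (Fin (n - 2)) from v) = v'
    refine (inner_ambient _ _ _ _).trans ?_
    rw [inner_smul_left, inner_add_right, inner_smul_right, inner_smul_right, inner_smul_right,
      inner_sphIncl, real_inner_self_eq_norm_sq, norm_eq_of_mem_sphere]
    simp [Complex.inner]
    ring
  · intro q
    have hF := frenet_fst hz hb hS hU hκ hN2 hcount q.1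
    have h1 := hN1 q.1
    rw [hF] at h1
    obtain ⟨S, hS1, hS2⟩ := trace_shape_spiralProduct q (hzd q.1) (hbd q.1)
      (κ := -c * (1 + (n - 2 : ℕ) / b q.1 ^ (n - 2 + 1)))
      (by exact_mod_cast h1) (hN2 q.1) (hpos q.1).ne'
    refine ⟨S, hS1, hS2.trans ?_⟩
    -- In `κ - m ν₂ / b` the terms with `b ^ (-(m + 1))` cancel, leaving `-(m + 1) c`.
    have h2 := hfirst q.1
    have h3 := (hpos q.1).ne'
    obtain ⟨m, rfl⟩ : ∃ m, n = m + 2 := ⟨n - 2, by omega⟩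
    simp only [Nat.add_sub_cancel] at h2 ⊢
    push_cast
    field_simp
    rw [pow_succ] at h2 ⊢
    linear_combination (m : ℝ) * b q.1 * h2

end

/-! ### Descent to the product of a circle and a sphere. -/

section
variable {F : Type*} [NormedAddCommGroup F] [NormedSpace ℝ F]
  {X : Type*} [TopologicalSpace X] {I : ModelWithCorners ℝ F X}
  {M : Type*} [TopologicalSpace M] [ChartedSpace X M]
  {F' : Type*} [NormedAddCommGroup F'] [NormedSpace ℝ F']
  {X' : Type*} [TopologicalSpace X'] {I' : ModelWithCorners ℝ F' X'}
  {M' : Type*} [TopologicalSpace M'] [ChartedSpace X' M']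
  {E : Type*} [NormedAddCommGroup E] [InnerProductSpace ℝ E]

theorem differential_comp {f : M → E} {f' : M' → E} {p : M'} {ψ : M' → M}
    {D : TangentSpace I' p →L[ℝ] TangentSpace I (ψ p)}
    (hf : MDifferentiableAt I 𝓘(ℝ, E) f (ψ p)) (hψ : HasMFDerivAt I' I ψ p D)
    (h : f' =ᶠ[𝓝 p] f ∘ ψ) (v : TangentSpace I' p) :
    differential I' f' p v = differential I f (ψ p) (D v) := by
  have := ((hf.hasMFDerivAt.comp p hψ).congr_of_eventuallyEq h).mfderiv
  unfold differential
  rw [this]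
  rfl

/-- Constant mean curvature is inherited along local diffeomorphisms. -/
theorem IsCMCImmersion.of_local_diffeo {f N : M → E} {f' N' : M' → E} {H : ℝ}
    (h : IsCMCImmersion I f N H)
    (hloc : ∀ p, ∃ (ψ : M' → M) (e : TangentSpace I' p ≃L[ℝ] TangentSpace I (ψ p)),
      ContMDiffAt I' I ∞ ψ p ∧
      HasMFDerivAt I' I ψ p (e : TangentSpace I' p →L[ℝ] TangentSpace I (ψ p)) ∧
      f' =ᶠ[𝓝 p] f ∘ ψ ∧ N' =ᶠ[𝓝 p] N ∘ ψ) :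
    IsCMCImmersion I' f' N' H := by
  have hfd (x : M) := h.contMDiff.mdifferentiableAt (x := x) (by simp)
  have hNd (x : M) := h.contMDiff_normal.mdifferentiableAt (x := x) (by simp)
  refine ⟨fun p => ?_, fun p => ?_, fun p => ?_, fun p => ?_, fun p => ?_, fun p => ?_,
    fun p v => ?_, fun p => ?_⟩ <;>
  obtain ⟨ψ, e, hψ, hd, hf, hN⟩ := hloc p
  · exact ((h.contMDiff (ψ p)).comp p hψ).congr_of_eventuallyEq hf
  · rw [hf.eq_of_nhds]; exact h.mem_sphere _
  · intro v w hvw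
    rw [differential_comp (hfd _) hd hf, differential_comp (hfd _) hd hf] at hvw
    exact e.injective (h.injective_differential _ hvw)
  · exact ((h.contMDiff_normal (ψ p)).comp p hψ).congr_of_eventuallyEq hN
  · rw [hN.eq_of_nhds]; exact h.norm_normal _
  · rw [hN.eq_of_nhds, hf.eq_of_nhds]; exact h.normal_orthogonal_position _
  · rw [hN.eq_of_nhds, differential_comp (hfd _) hd hf]
    exact h.normal_orthogonal_tangent _ _
  · obtain ⟨S, hS, htr⟩ := h.trace_shape (ψ p)
    refine ⟨e.symm.toLinearEquiv.conj S, fun v => ?_, ?_⟩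
    · rw [differential_comp (hfd _) hd hf, differential_comp (hNd _) hd hN]
      refine Eq.trans ?_ (hS (e v))
      congr 1
      exact e.apply_symm_apply _
    · exact (LinearMap.trace_conj' _ _).trans htr

end

theorem contMDiff_coe_circle : ContMDiff (𝓡 1) 𝓘(ℝ, ℂ) ∞ (fun w : Circle => (w : ℂ)) :=
  have := Fact.mk (show Module.finrank ℝ ℂ = 1 + 1 by simp)
  have h : ContMDiff (𝓡 1) 𝓘(ℝ, ℂ) ∞ ((↑) : Metric.sphere (0 : ℂ) 1 → ℂ) :=
    contMDiff_coe_sphere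
  h

/-- A local inverse of `t ↦ exp (2 π i t / L)`, smooth near `w₀`. -/
noncomputable def circleLift (L : ℝ) (w₀ w : Circle) : ℝ :=
  L / (2 * Real.pi) * (Complex.arg w₀ + Complex.arg (w₀⁻¹ * w : Circle))

theorem exp_circleLift {L : ℝ} (hL : 0 < L) (w₀ w : Circle) :
    Circle.exp (2 * Real.pi * circleLift L w₀ w / L) = w := by
  have : 2 * Real.pi * circleLift L w₀ w / L =
      Complex.arg w₀ + Complex.arg (w₀⁻¹ * w : Circle) := by
    have := Real.pi_ne_zero
    rw [circleLift]
    field_simp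
  rw [this, Circle.exp_add, Circle.exp_arg, Circle.exp_arg]
  simp

theorem contMDiffAt_circleLift (L : ℝ) (w₀ : Circle) :
    ContMDiffAt (𝓡 1) 𝓘(ℝ, ℝ) ∞ (circleLift L w₀) w₀ := by
  have h1 : ContMDiff (𝓡 1) 𝓘(ℝ, ℂ) ∞ (fun w : Circle => ((w₀⁻¹ * w : Circle) : ℂ)) :=
    contMDiff_coe_circle.comp (contMDiff_mul_left (I := 𝓡 1) (a := w₀⁻¹))
  have h2 : ContDiffAt ℝ ∞ (fun x : ℂ => L / (2 * Real.pi) * (Complex.arg w₀ + (Complex.log x).im))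
      ((w₀⁻¹ * w₀ : Circle) : ℂ) := by
    have h3 : ContDiffAt ℝ ∞ Complex.log ((w₀⁻¹ * w₀ : Circle) : ℂ) :=
      (Complex.contDiffAt_log (by simp)).restrict_scalars ℝ
    exact contDiffAt_const.mul (contDiffAt_const.add (Complex.imCLM.contDiff.contDiffAt.comp _ h3))
  have h3 : circleLift L w₀ = (fun x : ℂ => L / (2 * Real.pi) *
      (Complex.arg w₀ + (Complex.log x).im)) ∘ fun w : Circle => ((w₀⁻¹ * w : Circle) : ℂ) := by
    funext w
    simp [circleLift, Complex.log_im]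
  rw [h3]
  exact ContMDiffAt.comp (f := fun w : Circle => ((w₀⁻¹ * w : Circle) : ℂ)) w₀ h2.contMDiffAt
    (h1 w₀)

/-- The lift has the exponential as a left inverse, so its differential is injective; both tangent
spaces have dimension one. -/
theorem exists_equiv_circleLift {L : ℝ} (hL : 0 < L) (w₀ : Circle) :
    ∃ e : EuclideanSpace ℝ (Fin 1) ≃L[ℝ] ℝ,
      HasMFDerivAt (𝓡 1) 𝓘(ℝ, ℝ) (circleLift L w₀) w₀
        (e : EuclideanSpace ℝ (Fin 1) →L[ℝ] ℝ) := by
  have hd := ((contMDiffAt_circleLift L w₀).mdifferentiableAt (by simp)).hasMFDerivAt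
  have hexp : ContMDiff 𝓘(ℝ, ℝ) (𝓡 1) ∞ (fun t : ℝ => Circle.exp (2 * Real.pi * t / L)) :=
    contMDiff_circleExp.comp
      (show ContDiff ℝ ∞ (fun t : ℝ => 2 * Real.pi * t / L) by fun_prop).contMDiff
  have hed := (hexp.mdifferentiableAt (x := circleLift L w₀ w₀) (by simp)).hasMFDerivAt
  have hid : (fun t : ℝ => Circle.exp (2 * Real.pi * t / L)) ∘ circleLift L w₀ = id :=
    funext fun w => exp_circleLift hL w₀ w
  have hc := hed.comp w₀ hd
  rw [hid] at hc
  have hu := hasMFDerivAt_unique hc (hasMFDerivAt_id w₀)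
  let D : EuclideanSpace ℝ (Fin 1) →L[ℝ] ℝ := mfderiv (𝓡 1) 𝓘(ℝ, ℝ) (circleLift L w₀) w₀
  have hinj : Function.Injective D := by
    intro v w hvw
    have h1 := DFunLike.congr_fun hu v
    have h2 := DFunLike.congr_fun hu w
    refine Eq.trans (Eq.symm h1) (Eq.trans ?_ h2)
    exact congrArg (mfderiv 𝓘(ℝ, ℝ) (𝓡 1) (fun t : ℝ => Circle.exp (2 * Real.pi * t / L))
      (circleLift L w₀ w₀)) hvw
  let e := (LinearEquiv.ofInjectiveOfFinrankEq (D : EuclideanSpace ℝ (Fin 1) →ₗ[ℝ] ℝ) hinj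
    (by simp)).toContinuousLinearEquiv
  refine ⟨e, ?_⟩
  have : (e : EuclideanSpace ℝ (Fin 1) →L[ℝ] ℝ) = D := by
    ext v
    rfl
  rw [this]
  exact hd

/-- A periodic generating curve induces a closed constant mean curvature hypersurface. -/
theorem IsCompleteCMCCurve.exists_inducesClosed {n : ℕ} {H L : ℝ} {z : ℝ → ℂ} {b : ℝ → ℝ}
    (h : IsCompleteCMCCurve n H z b) (hL : 0 < L) (hz : Function.Periodic z L)
    (hb : Function.Periodic b L) :
    ∃ f N : Circle × Sph (n - 2) → Ambient n, InducesClosedCMCImmersion n H z b L f N := by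
  have hz' : Function.Periodic (deriv z) L := fun t => by
    rw [← deriv_comp_add_const, show (fun x => z (x + L)) = z from funext hz]
  have hb' : Function.Periodic (deriv b) L := fun t => by
    rw [← deriv_comp_add_const, show (fun x => b (x + L)) = b from funext hb]
  have key {s t : ℝ} (hst : Circle.exp (2 * Real.pi * s / L) = Circle.exp (2 * Real.pi * t / L))
      (x : Sph (n - 2)) : spiralProduct n z b (s, x) = spiralProduct n z b (t, x) ∧
        spiralNormal n z b (s, x) = spiralNormal n z b (t, x) := by
    obtain ⟨k, hk⟩ := Circle.exp_eq_exp.1 hst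
    have : s = t + k * L := by
      have := Real.pi_pos
      field_simp at hk
      linear_combination hk
    subst this
    have e1 := hz.int_mul k t
    have e2 := hb.int_mul k t
    have e3 := hz'.int_mul k t
    have e4 := hb'.int_mul k t
    simp only [spiralProduct, spiralNormal, e1, e2, e3, e4, and_self]
  -- The lift based at `1` may jump, but every `circleLift L w₀` is a right inverse of the
  -- exponential on the whole circle. By `key` the lift based at `p.1`, smooth near that point,
  -- gives the same `f` and `N`.
  let f : Circle × Sph (n - 2) → Ambient n := fun p => spiralProduct n z b (circleLift L 1 p.1, p.2)
  let N : Circle × Sph (n - 2) → Ambient n := fun p => spiralNormal n z b (circleLift L 1 p.1, p.2)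
  refine ⟨f, N, hL, hz, hb, fun t x => (key (exp_circleLift hL _ _) x).1,
    fun t x => (key (exp_circleLift hL _ _) x).2, h.cmc.of_local_diffeo fun p => ?_⟩
  obtain ⟨e, he⟩ := exists_equiv_circleLift hL p.1
  refine ⟨Prod.map (circleLift L p.1) id,
    e.prodCongr (ContinuousLinearEquiv.refl ℝ (EuclideanSpace ℝ (Fin (n - 2)))), ?_, ?_, ?_, ?_⟩
  · exact (contMDiffAt_circleLift L p.1).prodMap contMDiffAt_id
  · have := he.prodMap (hasMFDerivAt_id (I := 𝓡 (n - 2)) p.2)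
    rw [he.mfderiv, mfderiv_id] at this
    exact this
  · exact Filter.Eventually.of_forall fun q =>
      (key (by rw [exp_circleLift hL, exp_circleLift hL]) q.2).1
  · exact Filter.Eventually.of_forall fun q =>
      (key (by rw [exp_circleLift hL, exp_circleLift hL]) q.2).2

/-! ### Algebra of the speed equation. -/

/-- The geometric sum `1 + u + ... + u ^ m`. -/
noncomputable def geomS (m : ℕ) (u : ℝ) : ℝ := ∑ i ∈ Finset.range (m + 1), u ^ i

/-- The divided difference of `geomS`. -/
noncomputable def geomD (m : ℕ) (u v : ℝ) : ℝ :=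
  ∑ i ∈ Finset.range (m + 1), ∑ j ∈ Finset.range i, u ^ j * v ^ (i - 1 - j)

theorem geomD_mul (m : ℕ) (u v : ℝ) : geomD m u v * (u - v) = geomS m u - geomS m v := by
  rw [geomD, geomS, geomS, Finset.sum_mul, ← Finset.sum_sub_distrib]
  exact Finset.sum_congr rfl fun i _ => (Commute.all u v).geom_sum₂_mul i

theorem geomS_pos {u : ℝ} (m : ℕ) (hu : 0 < u) : 0 < geomS m u :=
  Finset.sum_pos (fun i _ => by positivity) (by simp)

theorem geomD_nonneg {u v : ℝ} (m : ℕ) (hu : 0 < u) (hv : 0 < v) : 0 ≤ geomD m u v :=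
  Finset.sum_nonneg fun i _ => Finset.sum_nonneg fun j _ => by positivity

theorem geomS_mono {u v : ℝ} (m : ℕ) (hu : 0 < u) (huv : u ≤ v) : geomS m u ≤ geomS m v :=
  Finset.sum_le_sum fun i _ => by gcongr

/-- Cancels the factor `1 - b` from the first integral, so that `θ'` has no singularity at the pole.
-/
theorem pow_mul_geomS_inv {b : ℝ} (m : ℕ) (hb : b ≠ 0) :
    b ^ m * ((1 - b) * geomS m b⁻¹) = 1 - b ^ (m + 1) := by
  have h := mul_geom_sum b⁻¹ (m + 1)
  change (b⁻¹ - 1) * geomS m b⁻¹ = _ at h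
  have h2 : (1 - b) = b * (b⁻¹ - 1) := by field_simp
  have h3 : b ^ (m + 1) * b⁻¹ ^ (m + 1) = 1 := by rw [← mul_pow, mul_inv_cancel₀ hb, one_pow]
  rw [h2, mul_assoc, h]
  rw [pow_succ] at h3 ⊢
  linear_combination h3

/-- The quantity controlling the speed of the height of a profile curve with minimal height `a`
at height `b`. -/
noncomputable def psi (m : ℕ) (a b : ℝ) : ℝ :=
  2 * geomS m a⁻¹ ^ 2 +
    (1 + a) * (1 - b) * ((geomS m a⁻¹ + geomS m b⁻¹) * geomD m a⁻¹ b⁻¹ * (a⁻¹ * b⁻¹))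

theorem psi_pos {a b : ℝ} (m : ℕ) (ha : 0 < a) (hb : 0 < b) (hb1 : b ≤ 1) : 0 < psi m a b := by
  have h1 := geomS_pos m (inv_pos.2 ha)
  have h2 := geomS_pos m (inv_pos.2 hb)
  have h3 := geomD_nonneg m (inv_pos.2 ha) (inv_pos.2 hb)
  have h4 : 0 ≤ 1 - b := by linarith
  unfold psi
  positivity

/-- Up to a positive constant the right side is `b' ^ 2 / (1 - b)`. It vanishes at `b = a`, and
`psi` is the quotient, manifestly positive for `b ≤ 1`. -/
theorem sub_mul_psi {a b : ℝ} (m : ℕ) (ha : 0 < a) (hb : 0 < b) :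
    (b - a) * psi m a b =
      (1 + b) * (1 - a) * geomS m a⁻¹ ^ 2 - (1 + a) * (1 - b) * geomS m b⁻¹ ^ 2 := by
  have h := geomD_mul m a⁻¹ b⁻¹
  have h2 : (b - a) * (a⁻¹ * b⁻¹) = a⁻¹ - b⁻¹ := by field_simp
  unfold psi
  linear_combination ((1 + a) * (1 - b) * (geomS m a⁻¹ + geomS m b⁻¹)) * h +
    (1 + a) * (1 - b) * (geomS m a⁻¹ + geomS m b⁻¹) * geomD m a⁻¹ b⁻¹ * h2

/-- The constant `h / (n - 1)` of the flower type curve of minimal height `a`. -/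
noncomputable def flowerConst (m : ℕ) (a : ℝ) : ℝ :=
  √(1 + a) / (√(1 - a) * geomS m a⁻¹)

theorem flowerConst_pos {a : ℝ} (m : ℕ) (ha : 0 < a) (ha1 : a < 1) : 0 < flowerConst m a := by
  have h1 := geomS_pos m (inv_pos.2 ha)
  have h2 : 0 < √(1 - a) := Real.sqrt_pos.2 (by linarith)
  unfold flowerConst
  positivity

/-- Ensures that different minimal heights give different mean curvatures. -/
theorem flowerConst_strictMonoOn (m : ℕ) : StrictMonoOn (flowerConst m) (Set.Ioo 0 1) := by
  intro a ha b hb hab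
  have h1 := geomS_pos m (inv_pos.2 hb.1)
  have h2 : 0 < √(1 - b) := Real.sqrt_pos.2 (by linarith [hb.2])
  have h3 : geomS m b⁻¹ ≤ geomS m a⁻¹ :=
    geomS_mono m (inv_pos.2 hb.1) (inv_anti₀ ha.1 hab.le)
  have h4 : √(1 - b) ≤ √(1 - a) := Real.sqrt_le_sqrt (by linarith)
  have h5 : √(1 + a) < √(1 + b) := Real.sqrt_lt_sqrt (by linarith [ha.1]) (by linarith)
  unfold flowerConst
  gcongr

/-! ### The profile curve in the regularizing parameter `x`. -/

/-- The height of the profile curve in the parameter `x`. -/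
noncomputable def hgt (a x : ℝ) : ℝ := 1 - (1 - a) * Real.sin x ^ 2

/-- The speed of the parameter `x` with respect to arc length. -/
noncomputable def spd (m : ℕ) (a x : ℝ) : ℝ :=
  √(psi m a (hgt a x)) / (2 * √(1 - a) * geomS m a⁻¹)

/-- The derivative of the polar angle with respect to the parameter `x`. -/
noncomputable def angleRate (m : ℕ) (a x : ℝ) : ℝ :=
  2 * √(1 + a) * geomS m (hgt a x)⁻¹ / ((1 + hgt a x) * √(psi m a (hgt a x)))

/-- The signed radius of the profile curve in the parameter `x`. -/
noncomputable def rad (a x : ℝ) : ℝ := √(1 - a) * Real.sin x * √(1 + hgt a x)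

theorem hgt_le {a : ℝ} (ha : a ≤ 1) (x : ℝ) : hgt a x ≤ 1 := by
  have := mul_nonneg (sub_nonneg.2 ha) (sq_nonneg (Real.sin x))
  unfold hgt; linarith

theorem hgt_ge {a : ℝ} (ha : a ≤ 1) (x : ℝ) : a ≤ hgt a x := by
  have := mul_nonneg (sub_nonneg.2 ha) (sq_nonneg (Real.cos x))
  rw [Real.cos_sq'] at this
  unfold hgt; linarith

theorem hgt_pos {a : ℝ} (ha0 : 0 < a) (ha : a ≤ 1) (x : ℝ) : 0 < hgt a x :=
  ha0.trans_le (hgt_ge ha x)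

theorem hgt_add_pi (a x : ℝ) : hgt a (x + Real.pi) = hgt a x := by
  simp [hgt, Real.sin_add_pi]

theorem contDiff_hgt (a : ℝ) : ContDiff ℝ ∞ (hgt a) := by
  unfold hgt; fun_prop

theorem contDiff_geomS (m : ℕ) : ContDiff ℝ ∞ (geomS m) := by
  unfold geomS; fun_prop

theorem contDiff_geomD (m : ℕ) (u : ℝ) : ContDiff ℝ ∞ (geomD m u) := by
  unfold geomD; fun_prop

section
variable {m : ℕ} {a : ℝ}

theorem contDiff_inv_hgt (ha0 : 0 < a) (ha : a ≤ 1) : ContDiff ℝ ∞ fun x => (hgt a x)⁻¹ :=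
  (contDiff_hgt a).inv fun x => (hgt_pos ha0 ha x).ne'

theorem contDiff_sqrt_psi (ha0 : 0 < a) (ha : a ≤ 1) :
    ContDiff ℝ ∞ fun x => √(psi m a (hgt a x)) := by
  have h1 := contDiff_inv_hgt ha0 ha
  have h2 := (contDiff_geomS m).comp h1
  have h3 := (contDiff_geomD m a⁻¹).comp h1
  have h4 := contDiff_hgt a
  refine ContDiff.sqrt ?_ fun x => (psi_pos m ha0 (hgt_pos ha0 ha x) (hgt_le ha x)).ne'
  unfold psi
  exact contDiff_const.add ((contDiff_const.mul (contDiff_const.sub h4)).mul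
    (((contDiff_const.add h2).mul h3).mul (contDiff_const.mul h1)))

theorem contDiff_spd (ha0 : 0 < a) (ha : a ≤ 1) : ContDiff ℝ ∞ (spd m a) :=
  (contDiff_sqrt_psi ha0 ha).div_const _

theorem sqrt_psi_pos (ha0 : 0 < a) (ha : a ≤ 1) (x : ℝ) : 0 < √(psi m a (hgt a x)) :=
  Real.sqrt_pos.2 (psi_pos m ha0 (hgt_pos ha0 ha x) (hgt_le ha x))

theorem spd_pos (ha0 : 0 < a) (ha : a < 1) (x : ℝ) : 0 < spd m a x := by
  have h1 := geomS_pos m (inv_pos.2 ha0)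
  have h2 : 0 < √(1 - a) := Real.sqrt_pos.2 (by linarith)
  have h3 := sqrt_psi_pos (m := m) ha0 ha.le x
  unfold spd
  positivity

theorem contDiff_angleRate (ha0 : 0 < a) (ha : a ≤ 1) : ContDiff ℝ ∞ (angleRate m a) := by
  refine ContDiff.div (contDiff_const.mul ((contDiff_geomS m).comp (contDiff_inv_hgt ha0 ha)))
    ((contDiff_const.add (contDiff_hgt a)).mul (contDiff_sqrt_psi ha0 ha)) fun x => ?_
  have h1 := hgt_pos ha0 ha x
  have h3 := sqrt_psi_pos (m := m) ha0 ha x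
  positivity

theorem contDiff_rad (ha0 : 0 < a) (ha : a ≤ 1) : ContDiff ℝ ∞ (rad a) := by
  refine (contDiff_const.mul Real.contDiff_sin).mul
    ((contDiff_const.add (contDiff_hgt a)).sqrt fun x => ?_)
  have := hgt_pos ha0 ha x
  positivity

theorem hasDerivAt_hgt (a x : ℝ) :
    HasDerivAt (hgt a) (-(2 * (1 - a) * Real.sin x * Real.cos x)) x := by
  unfold hgt
  convert! (((Real.hasDerivAt_sin x).pow 2).const_mul (1 - a)).const_sub 1 using 1
  simp; ring

theorem hasDerivAt_rad (ha0 : 0 < a) (ha : a ≤ 1) (x : ℝ) :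
    HasDerivAt (rad a) (2 * √(1 - a) * hgt a x * Real.cos x / √(1 + hgt a x)) x := by
  have h0 : 0 < 1 + hgt a x := by linarith [hgt_pos ha0 ha x]
  unfold rad
  convert! ((Real.hasDerivAt_sin x).const_mul √(1 - a)).mul
    (((hasDerivAt_hgt a x).const_add 1).sqrt h0.ne') using 1
  have h1 : 0 < √(1 + hgt a x) := Real.sqrt_pos.2 h0
  have h2 : √(1 + hgt a x) ^ 2 = 1 + hgt a x := Real.sq_sqrt h0.le
  have h3 : hgt a x = 1 - (1 - a) * Real.sin x ^ 2 := rfl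
  field_simp
  rw [h2]
  linear_combination √(1 - a) * Real.cos x * h3

theorem rad_sq (ha0 : 0 < a) (ha : a ≤ 1) (x : ℝ) : rad a x ^ 2 = 1 - hgt a x ^ 2 := by
  have h0 : 0 ≤ 1 + hgt a x := by linarith [hgt_pos ha0 ha x]
  have h3 : hgt a x = 1 - (1 - a) * Real.sin x ^ 2 := rfl
  unfold rad
  rw [mul_pow, mul_pow, Real.sq_sqrt h0, Real.sq_sqrt (by linarith)]
  linear_combination (1 + hgt a x) * h3

/-- This is the arc length derivative `θ'` prescribed by the first integral. Only in the product
does the factor `√(1 - a)` appear; `angleRate` itself stays regular at `a = 1`. -/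
theorem angleRate_mul_spd (ha0 : 0 < a) (ha : a < 1) (x : ℝ) :
    angleRate m a x * spd m a x =
      flowerConst m a * geomS m (hgt a x)⁻¹ / (1 + hgt a x) := by
  have h1 := geomS_pos m (inv_pos.2 ha0)
  have h2 : 0 < √(1 - a) := Real.sqrt_pos.2 (by linarith)
  have h3 := sqrt_psi_pos (m := m) ha0 ha.le x
  have h4 : 0 < 1 + hgt a x := by linarith [hgt_pos ha0 ha.le x]
  unfold angleRate spd flowerConst
  field_simp

/-- The profile curve has unit speed. -/
theorem unit_speed_profile (ha0 : 0 < a) (ha : a < 1) (x : ℝ) :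
    ((2 * √(1 - a) * hgt a x * Real.cos x / √(1 + hgt a x)) * spd m a x) ^ 2 +
      (rad a x * (angleRate m a x * spd m a x)) ^ 2 +
      (-(2 * (1 - a) * Real.sin x * Real.cos x) * spd m a x) ^ 2 = 1 := by
  have h1 := geomS_pos m (inv_pos.2 ha0)
  have hb := hgt_pos ha0 ha.le x
  have h4 : 0 < 1 + hgt a x := by linarith
  have h5 : 0 < 1 - a := by linarith
  have hspd : spd m a x ^ 2 = psi m a (hgt a x) / (4 * (1 - a) * geomS m a⁻¹ ^ 2) := by
    rw [spd, div_pow, mul_pow, mul_pow, Real.sq_sqrt h5.le,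
      Real.sq_sqrt (psi_pos m ha0 hb (hgt_le ha.le x)).le]
    norm_num
  have hc : flowerConst m a ^ 2 = (1 + a) / ((1 - a) * geomS m a⁻¹ ^ 2) := by
    rw [flowerConst, div_pow, mul_pow, Real.sq_sqrt h5.le, Real.sq_sqrt (by linarith)]
  have hψ := sub_mul_psi m ha0 hb
  have hs : (1 - a) * Real.sin x ^ 2 = 1 - hgt a x := by unfold hgt; ring
  have hcs : (1 - a) * Real.cos x ^ 2 = hgt a x - a := by rw [Real.cos_sq']; unfold hgt; ring
  rw [angleRate_mul_spd ha0 ha]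
  simp only [mul_pow, div_pow, rad_sq ha0 ha.le, hspd, hc, Real.sq_sqrt h5.le,
    Real.sq_sqrt h4.le, neg_sq]
  generalize geomS m (hgt a x)⁻¹ = s at *
  generalize geomS m a⁻¹ = r at *
  generalize psi m a (hgt a x) = p at *
  generalize hgt a x = b at *
  generalize Real.sin x ^ 2 = S at *
  generalize Real.cos x ^ 2 = C at *
  -- With `sin²` and `cos²` written through the height, unit speed reduces to `sub_mul_psi`.
  have e1 : C = (b - a) / (1 - a) := by field_simp; linarith
  have e2 : S = (1 - b) / (1 - a) := by field_simp; linarith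
  subst e1 e2
  field_simp
  linear_combination 4 * (1 + b) * hψ

end

/-! ### Arc length parametrization and the flower curve. -/

theorem integral_add_period {f : ℝ → ℝ} {p : ℝ} (hf : Continuous f) (hp : Function.Periodic f p)
    (x : ℝ) : ∫ y in 0..x + p, f y = (∫ y in 0..x, f y) + ∫ y in 0..p, f y := by
  have := hp.intervalIntegral_add_eq_add 0 x fun _ _ => hf.intervalIntegrable _ _
  simpa using this

/-- The autonomous equation `X' = w(X)` with a positive periodic `w` has a global solution, which
advances by the period of `w` in constant time. -/
theorem exists_periodic_flow {w : ℝ → ℝ} {p : ℝ} (hw : ContDiff ℝ ∞ w) (hpos : ∀ x, 0 < w x)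
    (hp0 : 0 < p) (hp : Function.Periodic w p) :
    ∃ (X : ℝ → ℝ) (T : ℝ), 0 < T ∧ ContDiff ℝ ∞ X ∧ X 0 = 0 ∧ Function.Injective X ∧
      (∀ t, HasDerivAt X (w (X t)) t) ∧ ∀ t, X (t + T) = X t + p := by
  have hc : Continuous fun x => (w x)⁻¹ := hw.continuous.inv₀ fun x => (hpos x).ne'
  have hper : Function.Periodic (fun x => (w x)⁻¹) p := fun x => by simp only [hp x]
  have hi : ∀ x y, IntervalIntegrable (fun x => (w x)⁻¹) MeasureTheory.volume x y :=
    fun _ _ => hc.intervalIntegrable _ _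
  -- Separation of variables: `τ` is the time needed to reach `x`, and the solution is its inverse.
  let τ : ℝ → ℝ := fun x => ∫ y in 0..x, (w y)⁻¹
  have hτ (x : ℝ) : HasDerivAt τ (w x)⁻¹ x := hc.integral_hasStrictDerivAt 0 x |>.hasDerivAt
  have hT : 0 < ∫ y in 0..p, (w y)⁻¹ :=
    intervalIntegral.intervalIntegral_pos_of_pos (hi _ _) (fun x => inv_pos.2 (hpos x)) hp0
  have hmono : StrictMono τ := strictMono_of_deriv_pos fun x => by
    rw [(hτ x).deriv]; exact inv_pos.2 (hpos x)
  have hτc : Continuous τ := continuous_iff_continuousAt.2 fun x => (hτ x).continuousAt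
  have hsurj : Function.Surjective τ := hτc.surjective
    (hper.tendsto_atTop_intervalIntegral_of_pos hT hp0)
    (hper.tendsto_atBot_intervalIntegral_of_pos hT hp0)
  let e := hmono.orderIsoOfSurjective τ hsurj
  have he (t : ℝ) : τ (e.symm t) = t := e.apply_symm_apply t
  have hd (t : ℝ) : HasDerivAt e.symm (w (e.symm t)) t := by
    have := HasDerivAt.of_local_left_inverse (e.symm.continuous.continuousAt (x := t))
      (hτ (e.symm t)) (inv_ne_zero (hpos _).ne') (Filter.Eventually.of_forall he)
    rwa [inv_inv] at this
  have hdiff : ContDiff ℝ ∞ e.symm := by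
    refine contDiff_infty.2 fun k => ?_
    induction k with
    | zero => exact contDiff_zero.2 e.symm.continuous
    | succ k ih =>
      -- Bootstrap: the equation makes the derivative as smooth as the solution.
      push_cast
      refine contDiff_succ_iff_deriv.2 ⟨fun t => (hd t).differentiableAt, by simp, ?_⟩
      rw [show deriv e.symm = w ∘ e.symm from funext fun t => (hd t).deriv]
      exact (hw.of_le (by exact_mod_cast le_top)).comp ih
  refine ⟨e.symm, _, hT, hdiff, ?_, e.symm.injective, hd, fun t => ?_⟩
  · apply e.injective
    rw [e.apply_symm_apply]
    exact (intervalIntegral.integral_same (f := fun y => (w y)⁻¹)).symm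
  · apply e.injective
    rw [e.apply_symm_apply]
    have h1 : τ (e.symm t + p) = τ (e.symm t) + ∫ y in 0..p, (w y)⁻¹ :=
      integral_add_period hc hper _
    rw [he] at h1
    exact h1.symm

/-- The angle swept by the profile curve of minimal height `a` between consecutive passages
through the pole. -/
noncomputable def sweptAngle (m : ℕ) (a : ℝ) : ℝ := ∫ x in 0..Real.pi, angleRate m a x

theorem spd_periodic (m : ℕ) (a : ℝ) : Function.Periodic (spd m a) Real.pi := fun x => by
  simp only [spd, hgt_add_pi]

theorem angleRate_periodic (m : ℕ) (a : ℝ) : Function.Periodic (angleRate m a) Real.pi := fun x => by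
  simp only [angleRate, hgt_add_pi]

theorem rad_add_pi (a x : ℝ) : rad a (x + Real.pi) = -rad a x := by
  simp [rad, hgt_add_pi, Real.sin_add_pi]

/-- The flower type curve of minimal height `a`; it is invariant, up to a rotation, under a
translation of the parameter. -/
theorem exists_flowerCurve {n : ℕ} (hn : 3 ≤ n) {a : ℝ} (ha0 : 0 < a) (ha : a < 1) :
    ∃ (z : ℝ → ℂ) (b : ℝ → ℝ) (T : ℝ), 0 < T ∧
      IsFlowerCurve n ((n - 1 : ℝ) * flowerConst (n - 2) a) z b ∧
      (∀ t, z (t + T) = -Complex.exp (sweptAngle (n - 2) a * Complex.I) * z t) ∧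
      ∀ t, b (t + T) = b t := by
  set m := n - 2
  obtain ⟨X, T, hT, hX, hX0, hinj, hXd, hXT⟩ := exists_periodic_flow
    (contDiff_spd (m := m) ha0 ha.le) (spd_pos ha0 ha) Real.pi_pos (spd_periodic m a)
  have hrate := contDiff_angleRate (m := m) ha0 ha.le
  let θ : ℝ → ℝ := fun x => ∫ y in 0..x, angleRate m a y
  have hθd (x : ℝ) : HasDerivAt θ (angleRate m a x) x :=
    hrate.continuous.integral_hasStrictDerivAt 0 x |>.hasDerivAt
  have hθ : ContDiff ℝ ∞ θ := contDiff_infty_iff_deriv.2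
    ⟨fun x => (hθd x).differentiableAt, by
      rwa [show deriv θ = angleRate m a from funext fun x => (hθd x).deriv]⟩
  let b : ℝ → ℝ := fun t => hgt a (X t)
  -- The signed radius keeps `z` smooth through the pole; its sign change over a period `π` produces
  -- the minus sign in the monodromy.
  let z : ℝ → ℂ := fun t => rad a (X t) * Complex.exp (θ (X t) * Complex.I)
  have hb : ContDiff ℝ ∞ b := (contDiff_hgt a).comp hX
  have hz : ContDiff ℝ ∞ z := by
    refine (Complex.ofRealCLM.contDiff.comp ((contDiff_rad ha0 ha.le).comp hX)).mul ?_
    exact ((Complex.ofRealCLM.contDiff.comp (hθ.comp hX)).mul contDiff_const).cexp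
  have hbd (t : ℝ) : HasDerivAt b _ t := (hasDerivAt_hgt a (X t)).comp t (hXd t)
  have hbd' (t : ℝ) : deriv b t = _ := (hbd t).deriv
  have hzd (t : ℝ) : deriv z t =
      (((2 * √(1 - a) * hgt a (X t) * Real.cos (X t) / √(1 + hgt a (X t))) * spd m a (X t) : ℝ) +
        ((rad a (X t) * (angleRate m a (X t) * spd m a (X t)) : ℝ)) * Complex.I) *
      Complex.exp (θ (X t) * Complex.I) := by
    have h1 := ((hasDerivAt_rad ha0 ha.le (X t)).comp t (hXd t)).ofReal_comp
    have h2 := ((((hθd (X t)).comp t (hXd t)).ofReal_comp).mul_const Complex.I).cexp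
    refine (h1.mul h2).deriv.trans ?_
    simp only [Function.comp_apply]
    push_cast
    ring
  have hS (t : ℝ) : ‖z t‖ ^ 2 + b t ^ 2 = 1 := by
    have : ‖z t‖ ^ 2 = rad a (X t) ^ 2 := by
      rw [norm_mul, Complex.norm_exp_ofReal_mul_I, mul_one, Complex.norm_real, Real.norm_eq_abs,
        sq_abs]
    rw [this, rad_sq ha0 ha.le]
    ring
  have hpos (t : ℝ) : 0 < b t := hgt_pos ha0 ha.le _
  have hU (t : ℝ) : ‖deriv z t‖ ^ 2 + deriv b t ^ 2 = 1 := by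
    rw [hzd, hbd', norm_mul, Complex.norm_exp_ofReal_mul_I, mul_one, Complex.sq_norm,
      Complex.normSq_add_mul_I]
    exact unit_speed_profile ha0 ha (X t)
  have hfirst (t : ℝ) : b t ^ m * (starRingEnd ℂ (z t) * deriv z t).im =
      flowerConst m a - flowerConst m a * b t ^ (m + 1) := by
    have h1 : starRingEnd ℂ (Complex.exp (θ (X t) * Complex.I)) *
        Complex.exp (θ (X t) * Complex.I) = 1 := by
      rw [← Complex.normSq_eq_conj_mul_self, Complex.normSq_eq_norm_sq,
        Complex.norm_exp_ofReal_mul_I]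
      simp
    have h2 : starRingEnd ℂ (z t) * deriv z t = rad a (X t) *
      (((2 * √(1 - a) * hgt a (X t) * Real.cos (X t) / √(1 + hgt a (X t))) * spd m a (X t) : ℝ) +
        ((rad a (X t) * (angleRate m a (X t) * spd m a (X t)) : ℝ)) * Complex.I) := by
      rw [hzd, map_mul, Complex.conj_ofReal]
      linear_combination rad a (X t) *
        (((2 * √(1 - a) * hgt a (X t) * Real.cos (X t) / √(1 + hgt a (X t))) *
          spd m a (X t) : ℝ) +
        ((rad a (X t) * (angleRate m a (X t) * spd m a (X t)) : ℝ)) * Complex.I) * h1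
    have h3 : (starRingEnd ℂ (z t) * deriv z t).im =
        rad a (X t) ^ 2 * (angleRate m a (X t) * spd m a (X t)) := by
      rw [h2, Complex.im_ofReal_mul, Complex.add_im, Complex.ofReal_im, Complex.im_ofReal_mul,
        Complex.I_im]
      ring
    have h4 : 1 + b t ≠ 0 := by have := hpos t; positivity
    rw [h3, rad_sq ha0 ha.le, angleRate_mul_spd ha0 ha]
    have h5 := pow_mul_geomS_inv m (hpos t).ne'
    change b t ^ m * ((1 - b t ^ 2) * (flowerConst m a * geomS m (b t)⁻¹ / (1 + b t))) = _
    have h6 : (1 - b t ^ 2) * (flowerConst m a * geomS m (b t)⁻¹ / (1 + b t)) =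
        flowerConst m a * ((1 - b t) * geomS m (b t)⁻¹) := by field_simp; ring
    rw [h6]
    linear_combination flowerConst m a * h5
  -- `b'` is a nonvanishing multiple of `sin (2 X)`, and `X` is injective.
  have hcount : {t | deriv b t = 0}.Countable := by
    have h1 : (Set.range fun k : ℤ => (k : ℝ) * Real.pi / 2).Countable := Set.countable_range _
    refine (h1.preimage_of_injOn (f := X) hinj.injOn).mono fun t ht => ?_
    have h2 : 0 < spd m a (X t) := spd_pos ha0 ha _
    have h3 : Real.sin (2 * X t) = 0 := by
      have h4 : deriv b t = 0 := ht
      rw [hbd'] at h4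
      have h5 : (1 - a) * spd m a (X t) ≠ 0 := mul_ne_zero (by linarith) h2.ne'
      rw [Real.sin_two_mul]
      apply mul_left_cancel₀ h5
      linear_combination -h4
    obtain ⟨k, hk⟩ := Real.sin_eq_zero_iff.1 h3
    exact ⟨k, by simp only; linarith⟩
  have hn1 : (n : ℝ) - 1 ≠ 0 := by
    have : (3 : ℝ) ≤ n := by exact_mod_cast hn
    linarith
  refine ⟨z, b, T, hT,
    { isCompleteCMCCurve_of_first_integral hn hz hb hS hpos hU hfirst hcount with
      passes_through_p := ⟨0, by simp [z, hX0, rad], by simp [b, hX0, hgt]⟩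
      first_integral := fun t => ?_ }, fun t => ?_, fun t => ?_⟩
  · rw [mul_div_cancel_left₀ _ hn1, show n - 1 = m + 1 by omega]
    exact hfirst t
  · have h1 : θ (X t + Real.pi) = θ (X t) + sweptAngle m a :=
      integral_add_period hrate.continuous (angleRate_periodic m a) _
    simp only [z, hXT, rad_add_pi, h1]
    push_cast
    rw [add_mul, Complex.exp_add]
    ring
  · simp only [b, hXT, hgt_add_pi]

/-! ### The swept angle: bound, limit value and continuity. -/

/-- Equality holds for `m = 1`. Each further degree adds `v ^ (m + 1)` on the left and, from the
term `j = 0` alone, at least `v ^ m * (1 + v)` on the right. -/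
theorem geomS_le_geomD_mul {m : ℕ} (hm : 1 ≤ m) {u v : ℝ} (hu : 0 < u) (hv : 0 < v) :
    geomS m v ≤ geomD m u v * (1 + v) := by
  induction m, hm using Nat.le_induction with
  | base => simp [geomS, geomD, Finset.sum_range_succ]
  | succ m hm ih =>
    have hS : geomS (m + 1) v = geomS m v + v ^ (m + 1) := Finset.sum_range_succ _ _
    have hD : geomD (m + 1) u v =
        geomD m u v + ∑ j ∈ Finset.range (m + 1), u ^ j * v ^ (m - j) := by
      simp [geomD, Finset.sum_range_succ _ (m + 1)]
    have h1 : v ^ m ≤ ∑ j ∈ Finset.range (m + 1), u ^ j * v ^ (m - j) := by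
      have := Finset.single_le_sum (f := fun j => u ^ j * v ^ (m - j))
        (fun j _ => by positivity) (Finset.mem_range.2 m.succ_pos)
      simpa using this
    have h2 : v ^ (m + 1) ≤ v ^ m * (1 + v) := by
      have : 0 < v ^ m := by positivity
      rw [pow_succ]; nlinarith
    have h3 : v ^ m * (1 + v) ≤ (∑ j ∈ Finset.range (m + 1), u ^ j * v ^ (m - j)) * (1 + v) := by
      gcongr
    rw [hS, hD, add_mul]
    linarith

/-- The squared form of `angleRate < 1`. Since `psi` increases with `r` and `d`, these may be
replaced by the lower bounds `hr` and `hd` in terms of `s`, which are equalities for `m = 1`. Then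
`s` cancels and `hpoly` remains, where each of the four terms is at least `a ^ 2`, and `a > a ^ 2`.
-/
theorem lt_sq_mul_psi {m : ℕ} (hm : 1 ≤ m) {a b : ℝ} (ha0 : 0 < a) (ha : a < 1) (hab : a ≤ b)
    (hb : b ≤ 1) : 4 * (1 + a) * geomS m b⁻¹ ^ 2 < (1 + b) ^ 2 * psi m a b := by
  have hb0 : 0 < b := ha0.trans_le hab
  have hs := geomS_pos m (inv_pos.2 hb0)
  have hD := geomS_le_geomD_mul hm (inv_pos.2 ha0) (inv_pos.2 hb0)
  have hSD := geomD_mul m a⁻¹ b⁻¹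
  have hba : 0 ≤ b - a := by linarith
  have h1b : 0 ≤ 1 - b := by linarith
  unfold psi
  generalize geomS m b⁻¹ = s at *
  generalize geomS m a⁻¹ = r at *
  generalize geomD m a⁻¹ b⁻¹ = d at *
  have hd : s * (b / (1 + b)) ≤ d := by
    rw [show (1 + b⁻¹) = (1 + b) / b by field_simp; ring] at hD
    calc s * (b / (1 + b)) ≤ (d * ((1 + b) / b)) * (b / (1 + b)) := by gcongr
      _ = d := by field_simp
  have hr : s * (b * (1 + a) / (a * (1 + b))) ≤ r := by
    have h1 : a⁻¹ - b⁻¹ = (b - a) / (a * b) := by field_simp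
    have h2 : r = s + d * ((b - a) / (a * b)) := by rw [← h1]; linarith
    calc s * (b * (1 + a) / (a * (1 + b)))
        = s + (s * (b / (1 + b))) * ((b - a) / (a * b)) := by field_simp; ring
      _ ≤ s + d * ((b - a) / (a * b)) := by gcongr
      _ = r := h2.symm
  have hpoly : 4 * a ^ 2 < b ^ 2 + a + b + a * b := by nlinarith
  calc 4 * (1 + a) * s ^ 2 = (1 + a) * s ^ 2 / a ^ 2 * (4 * a ^ 2) := by field_simp
    _ < (1 + a) * s ^ 2 / a ^ 2 * (b ^ 2 + a + b + a * b) := by gcongr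
    _ = (1 + b) ^ 2 * (2 * (s * (b * (1 + a) / (a * (1 + b)))) ^ 2 + (1 + a) * (1 - b) *
        ((s * (b * (1 + a) / (a * (1 + b))) + s) * (s * (b / (1 + b))) * (a⁻¹ * b⁻¹))) := by
      field_simp
      ring
    _ ≤ _ := by
      have : 0 ≤ s * (b / (1 + b)) := by positivity
      have : 0 ≤ r := le_trans (by positivity) hr
      gcongr

theorem angleRate_lt_one {m : ℕ} (hm : 1 ≤ m) {a : ℝ} (ha0 : 0 < a) (ha : a < 1) (x : ℝ) :
    angleRate m a x < 1 := by
  have hb := hgt_pos ha0 ha.le x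
  have hs := geomS_pos m (inv_pos.2 hb)
  have hψ := sqrt_psi_pos (m := m) ha0 ha.le x
  have h := lt_sq_mul_psi hm ha0 ha (hgt_ge ha.le x) (hgt_le ha.le x)
  rw [angleRate, div_lt_one (by positivity)]
  refine lt_of_pow_lt_pow_left₀ 2 (by positivity) ?_
  rw [mul_pow, mul_pow, mul_pow, Real.sq_sqrt (by linarith), Real.sq_sqrt
    (psi_pos m ha0 hb (hgt_le ha.le x)).le]
  linarith

theorem sweptAngle_lt_pi {m : ℕ} (hm : 1 ≤ m) {a : ℝ} (ha0 : 0 < a) (ha : a < 1) :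
    sweptAngle m a < Real.pi := by
  have h := intervalIntegral.integral_lt_integral_of_continuousOn_of_le_of_exists_lt
    (g := fun _ => 1) Real.pi_pos (contDiff_angleRate (m := m) ha0 ha.le).continuous.continuousOn
    continuousOn_const (fun x _ => (angleRate_lt_one hm ha0 ha x).le)
    ⟨0, ⟨le_rfl, Real.pi_pos.le⟩, angleRate_lt_one hm ha0 ha 0⟩
  simpa [sweptAngle] using h

/-- At `a = 1` the height is constantly `1`, and only the first summand of `psi` survives. -/
theorem sweptAngle_one (m : ℕ) : sweptAngle m 1 = Real.pi := by
  have hs := geomS_pos m one_pos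
  have h (x : ℝ) : angleRate m 1 x = 1 := by
    have h2 : √(2 : ℝ) ≠ 0 := by positivity
    simp only [angleRate, hgt, psi]
    norm_num [Real.sqrt_sq hs.le]
    field_simp
  simp [sweptAngle, h]

theorem continuousOn_sweptAngle (m : ℕ) {a₀ : ℝ} (ha₀ : 0 < a₀) :
    ContinuousOn (sweptAngle m) (Set.Icc a₀ 1) := by
  rw [continuousOn_iff_continuous_domRestrict]
  refine intervalIntegral.continuous_parametric_intervalIntegral_of_continuous'
    (f := fun (a : Set.Icc a₀ 1) x => angleRate m a x) ?_ 0 Real.pi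
  have ha (p : Set.Icc a₀ 1 × ℝ) : 0 < (p.1 : ℝ) := ha₀.trans_le p.1.2.1
  have hb (p : Set.Icc a₀ 1 × ℝ) : 0 < hgt p.1 p.2 := hgt_pos (ha p) p.1.2.2 p.2
  have hψ (p : Set.Icc a₀ 1 × ℝ) : 0 < √(psi m p.1 (hgt p.1 p.2)) :=
    sqrt_psi_pos (ha p) p.1.2.2 p.2
  have c0 : Continuous fun p : Set.Icc a₀ 1 × ℝ => (p.1 : ℝ) := by fun_prop
  have c1 : Continuous fun p : Set.Icc a₀ 1 × ℝ => hgt p.1 p.2 := by unfold hgt; fun_prop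
  have c2 : Continuous fun p : Set.Icc a₀ 1 × ℝ => (p.1 : ℝ)⁻¹ := c0.inv₀ fun p => (ha p).ne'
  have c3 : Continuous fun p : Set.Icc a₀ 1 × ℝ => (hgt p.1 p.2)⁻¹ := c1.inv₀ fun p => (hb p).ne'
  have c4 : Continuous fun p : Set.Icc a₀ 1 × ℝ => geomS m (p.1 : ℝ)⁻¹ :=
    (contDiff_geomS m).continuous.comp c2
  have c5 : Continuous fun p : Set.Icc a₀ 1 × ℝ => geomS m (hgt p.1 p.2)⁻¹ :=
    (contDiff_geomS m).continuous.comp c3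
  have c6 : Continuous fun p : Set.Icc a₀ 1 × ℝ => geomD m (p.1 : ℝ)⁻¹ (hgt p.1 p.2)⁻¹ := by
    unfold geomD; fun_prop
  have c7 : Continuous fun p : Set.Icc a₀ 1 × ℝ => psi m p.1 (hgt p.1 p.2) := by
    unfold psi; fun_prop
  unfold angleRate Function.uncurry
  refine Continuous.div (by fun_prop) (by fun_prop) fun p => ?_
  have h1 := hb p
  have h2 := hψ p
  positivity

/-! ### Closing up, and the choice of infinitely many `h`. -/

/-- The factor `2` removes the minus sign and turns `π r` into `2 π r`; the denominator then makes
it a full number of turns. -/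
theorem neg_exp_pow_eq_one (r : ℚ) :
    (-Complex.exp ((Real.pi * r : ℝ) * Complex.I)) ^ (2 * r.den) = 1 := by
  rw [pow_mul, neg_sq, ← pow_mul, ← Complex.exp_nat_mul, Complex.exp_eq_one_iff]
  refine ⟨r.num, ?_⟩
  have h : (r : ℂ) * r.den = r.num := by exact_mod_cast Rat.mul_den_eq_num r
  push_cast
  linear_combination (2 * Real.pi * Complex.I) * h

/-- A flower type curve which sweeps a rational multiple of `π` between passages through the
pole is periodic. -/
theorem exists_closed_flowerCurve {n : ℕ} (hn : 3 ≤ n) {a : ℝ} (ha0 : 0 < a) (ha : a < 1) {r : ℚ}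
    (hr : sweptAngle (n - 2) a = Real.pi * r) :
    ∃ (z : ℝ → ℂ) (b : ℝ → ℝ) (L : ℝ) (f N : Circle × Sph (n - 2) → Ambient n),
      IsFlowerCurve n ((n - 1 : ℝ) * flowerConst (n - 2) a) z b ∧
      InducesClosedCMCImmersion n (-((n - 1 : ℝ) * flowerConst (n - 2) a)) z b L f N := by
  obtain ⟨z, b, T, hT, hF, hz, hb⟩ := exists_flowerCurve hn ha0 ha
  have hb' : Function.Periodic b T := hb
  rw [hr] at hz
  set ζ := -Complex.exp ((Real.pi * r : ℝ) * Complex.I) with hζ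
  have hzk (k : ℕ) (t : ℝ) : z (t + k * T) = ζ ^ k * z t := by
    induction k with
    | zero => simp
    | succ k ih =>
      rw [show t + (k + 1 : ℕ) * T = t + k * T + T by push_cast; ring, hz, ih, pow_succ]
      ring
  have hzp : Function.Periodic z ((2 * r.den : ℕ) * T) := fun t => by
    rw [hzk, hζ, neg_exp_pow_eq_one, one_mul]
  have hL : 0 < ((2 * r.den : ℕ) : ℝ) * T := by
    have := r.den_pos
    positivity
  obtain ⟨f, N, h⟩ := hF.toIsCompleteCMCCurve.exists_inducesClosed hL hzp (hb'.nat_mul _)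
  exact ⟨z, b, _, f, N, hF, h⟩

theorem mainTheorem3 (n : ℕ) (hn : 3 ≤ n) :
    {h : ℝ | 0 < h ∧ ∃ (z : ℝ → ℂ) (b : ℝ → ℝ) (L : ℝ)
      (f N : Circle × Sph (n - 2) → Ambient n),
      IsFlowerCurve n h z b ∧ InducesClosedCMCImmersion n (-h) z b L f N}.Infinite := by
  have hm : 1 ≤ n - 2 := by omega
  have hn1 : (0 : ℝ) < n - 1 := by
    have : (3 : ℝ) ≤ n := by exact_mod_cast hn
    linarith
  -- Any height in `(0, 1)` would serve in place of `1 / 2`.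
  have hlt := sweptAngle_lt_pi hm (a := 1 / 2) (by norm_num) (by norm_num)
  have hivt := intermediate_value_Ioo (by norm_num)
    (continuousOn_sweptAngle (n - 2) (a₀ := 1 / 2) (by norm_num))
  rw [sweptAngle_one] at hivt
  obtain ⟨q₁, hq₁, hq₁'⟩ := exists_rat_btwn ((div_lt_one Real.pi_pos).2 hlt)
  have hq : q₁ < 1 := by exact_mod_cast hq₁'
  have hex (r : ℚ) (hr : r ∈ Set.Ioo q₁ 1) :
      ∃ a ∈ Set.Ioo (0 : ℝ) 1, sweptAngle (n - 2) a = Real.pi * r := by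
    have h1 : (q₁ : ℝ) < r := by exact_mod_cast hr.1
    have h2 : (r : ℝ) < 1 := by exact_mod_cast hr.2
    rw [div_lt_iff₀ Real.pi_pos] at hq₁
    obtain ⟨a, ha, har⟩ := hivt (a := Real.pi * r)
      ⟨by nlinarith [Real.pi_pos], by nlinarith [Real.pi_pos]⟩
    exact ⟨a, ⟨by linarith [ha.1], ha.2⟩, har⟩
  choose! a ha har using hex
  refine Set.infinite_of_injOn_mapsTo (f := fun r => (n - 1 : ℝ) * flowerConst (n - 2) (a r))
    (fun r hr s hs hrs => ?_) (fun r hr => ?_) (Set.Ioo_infinite hq)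
  · have h1 : a r = a s := (flowerConst_strictMonoOn (n - 2)).injOn (ha r hr) (ha s hs)
      (mul_left_cancel₀ hn1.ne' hrs)
    have h2 := har r hr
    rw [h1, har s hs] at h2
    exact_mod_cast (mul_left_cancel₀ Real.pi_ne_zero h2).symm
  · exact ⟨mul_pos hn1 (flowerConst_pos _ (ha r hr).1 (ha r hr).2),
      exists_closed_flowerCurve hn (ha r hr).1 (ha r hr).2 (har r hr)⟩
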